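/- Let $R$ be a commutative ring with identity and let $C$ be a semidualizing $R$-module, i.e. $C$ has a projective resolution by finitely generated projective modules, the homothety map $R\to\operatorname{Hom}_R(C,C)$ is an isomorphism, and $\operatorname{Ext}_R^i(C,C)=0$ for all $i\ge 1$. An $R$-module is called $C$-projective (resp. $C$-flat) if it is isomorphic to $C\otimes_R P$ with $P$ projective (resp. to $C\otimes_R F$ with $F$ flat). A ($\mathbb Z$-indexed, possibly unbounded) complex $X$ of $R$-modules is called projective (resp. $C$-projective, $C$-flat) if $X$ is exact and every cycle module $Z_i(X)$, $i\in\mathbb Z$, is a projective (resp. $C$-projective, $C$-flat) module. A complex $X$ is called $D_C$-projective if there is an exact sequence of complexes $$\cdots\longrightarrow P_1\xrightarrow{f_1}P_0\xrightarrow{f_0}Q_{-1}\xrightarrow{f_{-1}}Q_{-2}\longrightarrow\cdots$$ with all $P_i$ projective complexes and all $Q_i$ $C$-projective complexes, which remains exact after applying $\operatorname{Hom}(-,H)$ (the group of morphisms of complexes) for every $C$-flat complex $H$, and such that $X\cong\operatorname{Im} f_0$. Then every projective complex of $R$-modules is $D_C$-projective, and every $C$-projective complex of $R$-modules is $D_C$-projective.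 -/

import Mathlib

open CategoryTheory
open scoped TensorProduct

universe u

/-- An `R`-module `C` over a commutative ring is semidualizing if it has a projective resolution by
finitely generated projective modules, the homothety map `R → Hom_R(C, C)`, `r ↦ (c ↦ r • c)`, is
bijective, and `Ext_R^i(C, C) = 0` for all `i ≥ 1`. -/
structure IsSemidualizing {R : Type u} [CommRing R] (C : ModuleCat.{u} R) : Prop where
  exists_finite_resolution :
    ∃ P : ProjectiveResolution C, ∀ n : ℕ, Module.Finite R (P.complex.X n)
  bijective_homothety : Function.Bijective (LinearMap.lsmul R C : R → (C →ₗ[R] C))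
  subsingleton_ext : ∀ i : ℕ, 1 ≤ i → Subsingleton (Abelian.Ext C C i)

/-- The class of projective `R`-modules. -/
def projectiveModules (R : Type u) [CommRing R] : ObjectProperty (ModuleCat.{u} R) :=
  fun M => Module.Projective R M

/-- The class of `C`-projective modules: the modules `C ⊗ P` with `P` projective, up to
isomorphism. -/
def cProjectiveModules {R : Type u} [CommRing R] (C : ModuleCat.{u} R) :
    ObjectProperty (ModuleCat.{u} R) :=
  fun M => ∃ P : ModuleCat.{u} R, Module.Projective R P ∧ Nonempty (M ≃ₗ[R] C ⊗[R] P)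

/-- The class of `C`-flat modules: the modules `C ⊗ F` with `F` flat, up to isomorphism. -/
def cFlatModules {R : Type u} [CommRing R] (C : ModuleCat.{u} R) :
    ObjectProperty (ModuleCat.{u} R) :=
  fun M => ∃ F : ModuleCat.{u} R, Module.Flat R F ∧ Nonempty (M ≃ₗ[R] C ⊗[R] F)

/-- For a class `𝒳` of modules, the class of `𝒳`-complexes: the exact (`ℤ`-indexed, possibly
unbounded) complexes all of whose cycle modules `Z_i` belong to `𝒳`. -/
def complexesOf {R : Type u} [CommRing R] (𝒳 : ObjectProperty (ModuleCat.{u} R)) :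
    ObjectProperty (ChainComplex (ModuleCat.{u} R) ℤ) :=
  fun X => X.Acyclic ∧ ∀ i : ℤ, 𝒳 (X.cycles i)

/-- A sequence `⋯ ⟶ T₁ ⟶ T₀ ⟶ T₋₁ ⟶ ⋯` in a preadditive category is `Hom(-, ℬ)`-exact if, for every
`B` in the class `ℬ`, the sequence
`⋯ ⟶ Hom(T₋₁, B) ⟶ Hom(T₀, B) ⟶ Hom(T₁, B) ⟶ ⋯` is exact. -/
def IsHomExact {𝒜 : Type*} [Category 𝒜] [Preadditive 𝒜] (ℬ : ObjectProperty 𝒜)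
    (T : ChainComplex 𝒜 ℤ) : Prop :=
  ∀ B : 𝒜, ℬ B → ∀ i : ℤ,
    Function.Exact (fun g : T.X (i - 1) ⟶ B => T.d i (i - 1) ≫ g)
      (fun g : T.X i ⟶ B => T.d (i + 1) i ≫ g)

/-- A complex `X` is `D_C`-projective if there is an exact sequence of complexes
`⋯ ⟶ T₁ ⟶ T₀ ⟶ T₋₁ ⟶ T₋₂ ⟶ ⋯` which is `Hom(-, H)`-exact for all `C`-flat complexes `H`, with `Tᵢ` a
projective complex for `i ≥ 0` and a `C`-projective complex for `i < 0`, such that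
`X ≅ Im (T₀ ⟶ T₋₁)`. The outer index of `T` is the position in the sequence; the objects `Tᵢ` are
complexes of modules themselves. -/
def IsDCProjective {R : Type u} [CommRing R] (C : ModuleCat.{u} R)
    (X : ChainComplex (ModuleCat.{u} R) ℤ) : Prop :=
  ∃ T : ChainComplex (ChainComplex (ModuleCat.{u} R) ℤ) ℤ,
    T.Acyclic ∧
    IsHomExact (complexesOf (cFlatModules C)) T ∧
    (∀ i : ℤ, 0 ≤ i → complexesOf (projectiveModules R) (T.X i)) ∧
    (∀ i : ℤ, i < 0 → complexesOf (cProjectiveModules C) (T.X i)) ∧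
    Nonempty (X ≅ Limits.image (T.d 0 (-1)))

/-! Both kinds of complexes split into disks, which reduces the claim to one sequence of modules for
`R` and one for `C`. Let `X` be projective or `C`-projective. Each sequence `0 → Z_n → X_n → Z_{n-1}
→ 0` splits: trivially in the first case, and because `Ext¹(C ⊗ P, C ⊗ F) = 0` in the second. So `X`
is a sum of disks on `B ⊗ Q n` with `Q n` projective, where `B = R` or `B = C`
(`exists_iso_diskTensor`). Take a resolution `P_•` of `C` by finitely generated projectives. The
sequence used for `C` is `⋯ → P₁ → P₀ → C → 0`, and the one for `R` is its dual `0 → R → Hom(P₀, C)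
→ Hom(P₁, C) → ⋯`, exact because `C` is semidualizing. Both stay exact under `Hom(-, C ⊗ F)` for
flat `F`: `Hom(P_n, C ⊗ F)` is `Hom(P_n, C) ⊗ F`, while `Hom(Hom(P_n, C), C ⊗ F)` is `P_n ⊗ F`,
because `F ≅ Hom(C, C ⊗ F)`. Forming disks keeps these properties
(`IsSemidualizing.isDCProjective_of_sequence`): morphisms from disks to `H` amount to linear maps
into the `H_n`, and each `H_n` is an extension of `C`-flat modules. -/

section ModuleLemmas

variable {R : Type*} [CommRing R]

/-! ### Tensor evaluation maps, and exactness under `Hom(-, H)` -/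

theorem Module.Projective.exists_dual_basis (P : Type*) [AddCommGroup P] [Module R P]
    [Module.Finite R P] [Module.Projective R P] :
    ∃ (n : ℕ) (b : Fin n → P) (b' : Fin n → P →ₗ[R] R), ∀ p, ∑ j, b' j p • b j = p := by
  obtain ⟨n, f, g, -, -, h⟩ := Module.Finite.exists_comp_eq_id_of_projective R P
  refine ⟨n, fun j => f (Pi.single j 1), fun j => LinearMap.proj j ∘ₗ g, fun p => ?_⟩
  conv_rhs => rw [← LinearMap.id_apply (R := R) p, ← h, LinearMap.comp_apply,
    pi_eq_sum_univ' (g p), map_sum]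
  refine Finset.sum_congr rfl fun j _ => ?_
  simp only [LinearMap.comp_apply, LinearMap.proj_apply, ← map_smul]

variable {A B D M N H F P : Type*} [AddCommGroup A] [Module R A] [AddCommGroup B] [Module R B]
  [AddCommGroup D] [Module R D] [AddCommGroup M] [Module R M] [AddCommGroup N] [Module R N]
  [AddCommGroup H] [Module R H] [AddCommGroup F] [Module R F] [AddCommGroup P] [Module R P]

theorem rTensorHomToHomRTensor_bijective [Module.Finite R P] [Module.Projective R P] :
    Function.Bijective (TensorProduct.rTensorHomToHomRTensor (.id R) P M F) := by
  obtain ⟨n, b, b', hb⟩ := Module.Projective.exists_dual_basis (R := R) P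
  let φ : (P →ₗ[R] M ⊗[R] F) →ₗ[R] (P →ₗ[R] M) ⊗[R] F :=
    ∑ j, (LinearMap.rTensor F (LinearMap.smulRightₗ (b' j) : M →ₗ[R] P →ₗ[R] M)) ∘ₗ
      LinearMap.applyₗ (b j)
  have h1 : φ ∘ₗ TensorProduct.rTensorHomToHomRTensor (.id R) P M F = LinearMap.id := by
    refine TensorProduct.ext' fun f x => ?_
    simp only [φ, LinearMap.comp_apply, LinearMap.sum_apply, LinearMap.applyₗ_apply_apply,
      TensorProduct.rTensorHomToHomRTensor_apply, LinearMap.rTensor_tmul, LinearMap.id_apply,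
      ← TensorProduct.sum_tmul]
    congr 1
    ext p
    conv_rhs => rw [← hb p]
    simp
  have h2 : TensorProduct.rTensorHomToHomRTensor (.id R) P M F ∘ₗ φ = LinearMap.id := by
    have key (j : Fin n) (y : M ⊗[R] F) (p : P) :
        TensorProduct.rTensorHomToHomRTensor (.id R) P M F
          (LinearMap.rTensor F (LinearMap.smulRightₗ (b' j) : M →ₗ[R] P →ₗ[R] M) y) p =
          b' j p • y := by
      induction y with
      | zero => simp
      | tmul m x => simp [TensorProduct.smul_tmul']
      | add y z hy hz => simp [hy, hz]
    ext g p
    conv_rhs => rw [← hb p]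
    simp [φ, key]
  exact Function.bijective_iff_has_inverse.mpr
    ⟨φ, fun x => LinearMap.congr_fun h1 x, fun x => LinearMap.congr_fun h2 x⟩

/-- The map `f ↦ (c ↦ c ⊗ f)`. -/
def coevalTensor (R M F : Type*) [CommRing R] [AddCommGroup M] [Module R M] [AddCommGroup F]
    [Module R F] : F →ₗ[R] M →ₗ[R] M ⊗[R] F :=
  (TensorProduct.mk R M F).flip

/-- The map `p ⊗ f ↦ (φ ↦ φ p ⊗ f)`. -/
def biduality (R M F P : Type*) [CommRing R] [AddCommGroup M] [Module R M] [AddCommGroup F]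
    [Module R F] [AddCommGroup P] [Module R P] : P ⊗[R] F →ₗ[R] (P →ₗ[R] M) →ₗ[R] M ⊗[R] F :=
  TensorProduct.lift
    (LinearMap.mk₂ R (fun p x => coevalTensor R M F x ∘ₗ LinearMap.applyₗ p)
      (fun p q x => by ext; simp) (fun c p x => by ext; simp)
      (fun p x y => by ext; simp) (fun c p x => by ext; simp))

@[simp]
theorem coevalTensor_apply (x : F) (m : M) : coevalTensor R M F x m = m ⊗ₜ[R] x := rfl

@[simp]
theorem biduality_tmul (p : P) (x : F) (φ : P →ₗ[R] M) :
    biduality R M F P (p ⊗ₜ x) φ = φ p ⊗ₜ[R] x := rfl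

/-- For `P = R` the map is essentially `coevalTensor`; a dual basis carries bijectivity over to `P`.
-/
theorem biduality_bijective [Module.Finite R P] [Module.Projective R P]
    (hM : Function.Bijective (coevalTensor R M F)) :
    Function.Bijective (biduality R M F P) := by
  obtain ⟨n, b, b', hb⟩ := Module.Projective.exists_dual_basis (R := R) P
  have key (j : Fin n) (y : P ⊗[R] F) :
      coevalTensor R M F (TensorProduct.lid R F (LinearMap.rTensor F (b' j) y)) =
        biduality R M F P y ∘ₗ LinearMap.smulRightₗ (b' j) := by
    induction y with
    | zero => simp
    | tmul m x => ext; simp [TensorProduct.smul_tmul']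
    | add y z hy hz => simp [hy, hz, LinearMap.add_comp]
  have dec (y : P ⊗[R] F) :
      ∑ j, b j ⊗ₜ[R] TensorProduct.lid R F (LinearMap.rTensor F (b' j) y) = y := by
    induction y with
    | zero => simp
    | tmul p x =>
      conv_rhs => rw [← hb p]
      simp [TensorProduct.sum_tmul, TensorProduct.smul_tmul]
    | add y z hy hz => simp [TensorProduct.tmul_add, Finset.sum_add_distrib, hy, hz]
  constructor
  · refine (injective_iff_map_eq_zero _).mpr fun y hy => ?_
    rw [← dec y]
    refine Finset.sum_eq_zero fun j _ => ?_
    have : TensorProduct.lid R F (LinearMap.rTensor F (b' j) y) = 0 :=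
      hM.1 (by rw [key, hy]; simp)
    rw [this, TensorProduct.tmul_zero]
  · intro θ
    -- Restricting `θ` along `m ↦ b' j (·) • m` gives a map `M → M ⊗ F`, which comes from an element
    -- of `F` by hypothesis: the `j`-th coordinate of the preimage.
    choose x hx using fun j => hM.2 (θ ∘ₗ LinearMap.smulRightₗ (b' j))
    refine ⟨∑ j, b j ⊗ₜ x j, ?_⟩
    ext φ
    have hφ : φ = ∑ j, LinearMap.smulRightₗ (b' j) (φ (b j)) := by
      ext p
      conv_lhs => rw [← hb p]
      simp
    conv_rhs => rw [hφ, map_sum]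
    simp only [map_sum, LinearMap.sum_apply, biduality_tmul]
    refine Finset.sum_congr rfl fun j _ => ?_
    simpa using LinearMap.congr_fun (hx j) (φ (b j))

/-- The sequence `A → B → D` becomes exact at `Hom(B, H)` after applying `Hom(-, H)`. -/
def HomExactAt (f : A →ₗ[R] B) (g : B →ₗ[R] D) (H : Type*) [AddCommGroup H] [Module R H] : Prop :=
  ∀ u : B →ₗ[R] H, u ∘ₗ f = 0 → ∃ v : D →ₗ[R] H, v ∘ₗ g = u

/-- Every linear map `A → N` lifts along `q : M → N`. -/
def LiftsAlong (A : Type*) [AddCommGroup A] [Module R A] (q : M →ₗ[R] N) : Prop :=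
  ∀ u : A →ₗ[R] N, ∃ v : A →ₗ[R] M, q ∘ₗ v = u

theorem Module.Projective.liftsAlong [Module.Projective R P] {q : M →ₗ[R] N}
    (hq : Function.Surjective q) : LiftsAlong P q :=
  fun u => Module.projective_lifting_property q u hq

/-- By adjunction a map out of `A ⊗ P` is a map `P → Hom(A, N)`, which lifts along the surjection
`Hom(A, M) → Hom(A, N)`. -/
theorem LiftsAlong.tensor {q : M →ₗ[R] N} (h : LiftsAlong A q) [Module.Projective R P] :
    LiftsAlong (A ⊗[R] P) q := by
  intro u
  obtain ⟨w, hw⟩ := Module.projective_lifting_property (LinearMap.llcomp R A M N q)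
    (TensorProduct.mk R A P |>.flip.compr₂ u) h
  refine ⟨TensorProduct.lift w.flip, TensorProduct.ext' fun a p => ?_⟩
  simpa using LinearMap.congr_fun (LinearMap.congr_fun hw p) a

theorem LiftsAlong.of_equiv {q : M →ₗ[R] N} (h : LiftsAlong A q) (e : B ≃ₗ[R] A) :
    LiftsAlong B q := by
  intro u
  obtain ⟨v, hv⟩ := h (u ∘ₗ e.symm)
  refine ⟨v ∘ₗ e, ?_⟩
  rw [← LinearMap.comp_assoc, hv]
  ext; simp

/-- Adjunction again: the curried map sends `P` into the image of `Hom(D, H) → Hom(B, H)`, so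
projectivity lets it lift to `Hom(D, H)`. -/
theorem HomExactAt.tensor {f : A →ₗ[R] B} {g : B →ₗ[R] D} (h : HomExactAt f g H)
    [Module.Projective R P] : HomExactAt (f.rTensor P) (g.rTensor P) H := by
  intro u hu
  let G : (D →ₗ[R] H) →ₗ[R] (B →ₗ[R] H) := LinearMap.lcomp R H g
  let U : P →ₗ[R] B →ₗ[R] H := (TensorProduct.mk R B P).flip.compr₂ u
  have hU (p : P) : U p ∈ LinearMap.range G := by
    obtain ⟨v, hv⟩ := h (U p) (by
      ext a
      simpa [U] using LinearMap.congr_fun hu (a ⊗ₜ p))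
    exact ⟨v, hv⟩
  obtain ⟨w, hw⟩ := Module.projective_lifting_property G.rangeRestrict
    (U.codRestrict _ hU) G.surjective_rangeRestrict
  refine ⟨TensorProduct.lift w.flip, TensorProduct.ext' fun b p => ?_⟩
  have := LinearMap.congr_fun (congrArg Subtype.val (LinearMap.congr_fun hw p)) b
  simpa [G, U] using this

theorem HomExactAt.of_equiv {f : A →ₗ[R] B} {g : B →ₗ[R] D} (h : HomExactAt f g H)
    (e : M ≃ₗ[R] H) : HomExactAt f g M := by
  intro u hu
  obtain ⟨v, hv⟩ := h (e.toLinearMap ∘ₗ u) (by rw [LinearMap.comp_assoc, hu, LinearMap.comp_zero])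
  refine ⟨e.symm.toLinearMap ∘ₗ v, ?_⟩
  rw [LinearMap.comp_assoc, hv]
  ext; simp

theorem exists_comp_eq_of_exact {i : H →ₗ[R] M} {q : M →ₗ[R] N} (hi : Function.Injective i)
    (hiq : Function.Exact i q) (u : A →ₗ[R] M) (hu : q ∘ₗ u = 0) :
    ∃ v : A →ₗ[R] H, i ∘ₗ v = u := by
  have hr (a : A) : u a ∈ LinearMap.range i :=
    (hiq (u a)).mp (LinearMap.congr_fun hu a)
  refine ⟨(LinearEquiv.ofInjective i hi).symm.toLinearMap ∘ₗ u.codRestrict _ hr, ?_⟩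
  ext a
  exact congrArg Subtype.val ((LinearEquiv.ofInjective i hi).apply_symm_apply ⟨u a, hr a⟩)

/-- A map to `M` is first extended modulo `H`. The lifting hypothesis, a form of `Ext¹(D, H) = 0`,
brings this extension back to `M`, and the remaining error takes values in `H`. -/
theorem HomExactAt.of_extension {f : A →ₗ[R] B} {g : B →ₗ[R] D} (hgf : g ∘ₗ f = 0)
    {i : H →ₗ[R] M} {q : M →ₗ[R] N}
    (hi : Function.Injective i) (hiq : Function.Exact i q) (hD : LiftsAlong D q)
    (hH : HomExactAt f g H) (hN : HomExactAt f g N) : HomExactAt f g M := by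
  intro u hu
  obtain ⟨v, hv⟩ := hN (q ∘ₗ u) (by rw [LinearMap.comp_assoc, hu, LinearMap.comp_zero])
  obtain ⟨w, hw⟩ := hD v
  obtain ⟨t, ht⟩ := exists_comp_eq_of_exact hi hiq (u - w ∘ₗ g) (by
    rw [LinearMap.comp_sub, ← LinearMap.comp_assoc, hw, hv, sub_self])
  obtain ⟨s, hs⟩ := hH t (by
    ext a
    apply hi
    have h1 := LinearMap.congr_fun ht (f a)
    have h2 := LinearMap.congr_fun hu a
    have h3 := LinearMap.congr_fun hgf a
    simp only [LinearMap.comp_apply, LinearMap.sub_apply, LinearMap.zero_apply] at h1 h2 h3 ⊢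
    rw [h1, h2, h3, map_zero, map_zero, sub_zero])
  refine ⟨w + i ∘ₗ s, ?_⟩
  rw [LinearMap.add_comp, LinearMap.comp_assoc, hs, ht]
  abel

theorem HomExactAt.of_exact {f : A →ₗ[R] B} {g : B →ₗ[R] D} (hfg : Function.Exact f g)
    (hg : Function.Surjective g) : HomExactAt f g H := by
  intro u hu
  have hker : LinearMap.ker g ≤ LinearMap.ker u := by
    intro x hx
    obtain ⟨y, rfl⟩ := (hfg x).mp hx
    exact LinearMap.congr_fun hu y
  refine ⟨(LinearMap.ker g).liftQ _ hker ∘ₗ (g.quotKerEquivOfSurjective hg).symm.toLinearMap, ?_⟩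
  ext x
  have : (g.quotKerEquivOfSurjective hg).symm (g x) = Submodule.Quotient.mk x := by
    rw [LinearEquiv.symm_apply_eq]; rfl
  simp [this]

/-- `Hom(A, -)` is right exact on `M → N` if some presentation `B₁ → B₀ → A` with `B₀` projective
is `Hom(-, H)`-exact at `B₁`, where `H` is the kernel of `M → N`. -/
theorem LiftsAlong.of_presentation {B₀ B₁ B₂ : Type*} [AddCommGroup B₀] [Module R B₀]
    [AddCommGroup B₁] [Module R B₁] [AddCommGroup B₂] [Module R B₂] [Module.Projective R B₀]
    {d₁ : B₂ →ₗ[R] B₁} {d₀ : B₁ →ₗ[R] B₀} {ε : B₀ →ₗ[R] A} (hd : d₀ ∘ₗ d₁ = 0)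
    (hdε : Function.Exact d₀ ε) (hε : Function.Surjective ε)
    {i : H →ₗ[R] M} {q : M →ₗ[R] N}
    (hi : Function.Injective i) (hiq : Function.Exact i q) (hq : Function.Surjective q)
    (hH : HomExactAt d₁ d₀ H) : LiftsAlong A q := by
  intro u
  -- The lift `ψ : B₀ → M` need not vanish on the relations `B₁`, but there it is a cocycle with
  -- values in `H`. Writing it as a coboundary `s ∘ d₀` corrects `ψ` to a map that factors through
  -- `A`.
  obtain ⟨ψ, hψ⟩ := Module.projective_lifting_property q (u ∘ₗ ε) hq
  obtain ⟨t, ht⟩ := exists_comp_eq_of_exact hi hiq (ψ ∘ₗ d₀) (by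
    rw [← LinearMap.comp_assoc, hψ, LinearMap.comp_assoc, hdε.linearMap_comp_eq_zero,
      LinearMap.comp_zero])
  obtain ⟨s, hs⟩ := hH t (by
    ext a
    apply hi
    have h1 := LinearMap.congr_fun ht (d₁ a)
    have h3 := LinearMap.congr_fun hd a
    simp only [LinearMap.comp_apply, LinearMap.zero_apply] at h1 h3 ⊢
    rw [h1, h3, map_zero, map_zero])
  obtain ⟨v, hv⟩ := HomExactAt.of_exact hdε hε (ψ - i ∘ₗ s) (by
    rw [LinearMap.sub_comp, LinearMap.comp_assoc, hs, ht, sub_self])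
  refine ⟨v, ?_⟩
  ext a
  obtain ⟨x, rfl⟩ := hε a
  have h1 := LinearMap.congr_fun hψ x
  have h2 : q (i (s x)) = 0 := (hiq _).mpr ⟨_, rfl⟩
  have h3 := LinearMap.congr_fun hv x
  simp only [LinearMap.comp_apply] at h1 h3
  simp [h3, h1, h2]

end ModuleLemmas

/-! ### The resolution of a semidualizing module and its dual -/

section Resolution

/-- `⋯ → P₁ → P₀ → C → 0` is a resolution by finitely generated projective modules, and
`0 → R → Hom(P₀, C) → Hom(P₁, C) → ⋯` is exact. -/
structure IsDualExactResolution {R : Type*} [CommRing R] {C : Type*} [AddCommGroup C] [Module R C]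
    {P : ℕ → Type*} [∀ n, AddCommGroup (P n)] [∀ n, Module R (P n)]
    (d : ∀ n, P (n + 1) →ₗ[R] P n) (ε : P 0 →ₗ[R] C) : Prop where
  finite : ∀ n, Module.Finite R (P n)
  projective : ∀ n, Module.Projective R (P n)
  surjective : Function.Surjective ε
  exact_zero : Function.Exact (d 0) ε
  exact_succ : ∀ n, Function.Exact (d (n + 1)) (d n)
  dual_injective : Function.Injective (LinearMap.toSpanSingleton R (P 0 →ₗ[R] C) ε)
  dual_exact_zero : Function.Exact (LinearMap.toSpanSingleton R (P 0 →ₗ[R] C) ε)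
    (LinearMap.lcomp R C (d 0))
  dual_exact_succ : ∀ n, Function.Exact (LinearMap.lcomp R C (d n))
    (LinearMap.lcomp R C (d (n + 1)))

/-- The homothety isomorphism identifies `R` with the kernel of `Hom(P₀, C) → Hom(P₁, C)`; the
vanishing of `Ext` gives exactness further on. -/
theorem IsSemidualizing.exists_dualExactResolution {R : Type u} [CommRing R] {C : ModuleCat.{u} R}
    (hC : IsSemidualizing C) :
    ∃ (P : ℕ → ModuleCat.{u} R) (d : ∀ n, P (n + 1) →ₗ[R] P n) (ε : P 0 →ₗ[R] C),
      IsDualExactResolution (P := fun n => P n) d ε := by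
  obtain ⟨P, hP⟩ := hC.exists_finite_resolution
  let ε : P.complex.X 0 ⟶ C := P.π.f 0
  have hε : Function.Surjective ε.hom :=
    (ModuleCat.epi_iff_surjective _).mp (inferInstanceAs (Epi (P.π.f 0)))
  have hdε : Function.Exact (P.complex.d 1 0).hom ε.hom := by
    have h : (ShortComplex.mk (P.complex.d 1 0) ε P.complex_d_comp_π_f_zero).Exact :=
      ShortComplex.exact_of_g_is_cokernel _ P.isColimitCokernelCofork
    exact (ShortComplex.ShortExact.moduleCat_exact_iff_function_exact _).mp h
  have hd (n : ℕ) : Function.Exact (P.complex.d (n + 2) (n + 1)).hom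
      (P.complex.d (n + 1) n).hom :=
    (ShortComplex.ShortExact.moduleCat_exact_iff_function_exact _).mp (P.exact_succ n)
  refine ⟨fun n => P.complex.X n, fun n => (P.complex.d (n + 1) n).hom, ε.hom, hP,
    fun n => (IsProjective.iff_projective _).mpr (P.projective n), hε, hdε, hd, ?_, ?_, ?_⟩
  · intro r s h
    apply hC.bijective_homothety.1
    ext c
    obtain ⟨p, rfl⟩ := hε c
    simpa using LinearMap.congr_fun h p
  · intro φ
    constructor
    · intro h
      obtain ⟨v, hv⟩ := HomExactAt.of_exact hdε hε φ h
      obtain ⟨r, hr⟩ := hC.bijective_homothety.2 v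
      refine ⟨r, ?_⟩
      rw [← hv, ← hr]
      rfl
    · rintro ⟨r, rfl⟩
      ext x
      have := hdε.apply_apply_eq_zero x
      simp [this]
  · intro n φ
    constructor
    · intro h
      have h' : P.complex.d (n + 2) (n + 1) ≫ ModuleCat.ofHom φ = 0 := by
        ext x; exact LinearMap.congr_fun h x
      have := hC.subsingleton_ext (n + 1) (by lia)
      obtain ⟨g, hg⟩ := (P.extMk_eq_zero_iff (ModuleCat.ofHom φ) (n + 2) rfl h' n rfl).mp
        (Subsingleton.elim _ _)
      refine ⟨g.hom, ?_⟩
      rw [← ModuleCat.hom_ofHom φ, ← hg]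
      rfl
    · rintro ⟨g, rfl⟩
      ext x
      have := (hd n).apply_apply_eq_zero x
      simp [this]

namespace IsDualExactResolution

variable {R : Type*} [CommRing R] {C : Type*} [AddCommGroup C] [Module R C]
  {P : ℕ → Type*} [∀ n, AddCommGroup (P n)] [∀ n, Module R (P n)]
  {d : ∀ n, P (n + 1) →ₗ[R] P n} {ε : P 0 →ₗ[R] C} (h : IsDualExactResolution d ε)
  (F : Type*) [AddCommGroup F] [Module R F] [Module.Flat R F]

include h

omit [Module.Flat R F] in
theorem homTensor_bijective (n : ℕ) :
    Function.Bijective (TensorProduct.rTensorHomToHomRTensor (.id R) (P n) C F) :=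
  have := h.finite n
  have := h.projective n
  rTensorHomToHomRTensor_bijective

/-- By flatness `F` is the kernel of `Hom(P₀, C) ⊗ F → Hom(P₁, C) ⊗ F`, and `Hom(C, C ⊗ F)` is the
kernel of `Hom(P₀, C ⊗ F) → Hom(P₁, C ⊗ F)`. Tensor evaluation identifies the two. -/
theorem coevalTensor_bijective : Function.Bijective (coevalTensor R C F) := by
  have e0 (x : R ⊗[R] F) : TensorProduct.rTensorHomToHomRTensor (.id R) (P 0) C F
      (LinearMap.rTensor F (LinearMap.toSpanSingleton R _ ε) x) =
        coevalTensor R C F (TensorProduct.lid R F x) ∘ₗ ε := by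
    induction x with
    | zero => simp
    | tmul r x => ext; simp [TensorProduct.smul_tmul']
    | add y z hy hz => simp [hy, hz, LinearMap.add_comp]
  have e1 (x : (P 0 →ₗ[R] C) ⊗[R] F) : TensorProduct.rTensorHomToHomRTensor (.id R) (P 1) C F
      (LinearMap.rTensor F (LinearMap.lcomp R C (d 0)) x) =
        TensorProduct.rTensorHomToHomRTensor (.id R) (P 0) C F x ∘ₗ d 0 := by
    induction x with
    | zero => simp
    | tmul r x => ext; simp
    | add y z hy hz => simp [hy, hz, LinearMap.add_comp]
  constructor
  · refine (injective_iff_map_eq_zero _).mpr fun x hx => ?_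
    have := e0 ((TensorProduct.lid R F).symm x)
    rw [LinearEquiv.apply_symm_apply, hx, LinearMap.zero_comp,
      map_eq_zero_iff _ (h.homTensor_bijective F 0).1,
      map_eq_zero_iff _ (Module.Flat.rTensor_preserves_injective_linearMap _ h.dual_injective)]
      at this
    simpa using this
  · intro θ
    obtain ⟨x, hx⟩ := (h.homTensor_bijective F 0).2 (θ ∘ₗ ε)
    have hx0 : LinearMap.rTensor F (LinearMap.lcomp R C (d 0)) x = 0 := by
      apply (h.homTensor_bijective F 1).1
      rw [e1, hx, LinearMap.comp_assoc, h.exact_zero.linearMap_comp_eq_zero, LinearMap.comp_zero,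
        map_zero]
    obtain ⟨y, rfl⟩ := (Module.Flat.rTensor_exact F h.dual_exact_zero x).mp hx0
    refine ⟨TensorProduct.lid R F y, ?_⟩
    rw [e0] at hx
    ext c
    obtain ⟨p, rfl⟩ := h.surjective c
    exact LinearMap.congr_fun hx p

/-- `Hom(P_•, C ⊗ F)` is exact in positive degrees. -/
theorem homExactAt_succ (n : ℕ) : HomExactAt (d (n + 1)) (d n) (C ⊗[R] F) := by
  have e (m : ℕ) (x : (P m →ₗ[R] C) ⊗[R] F) :
      TensorProduct.rTensorHomToHomRTensor (.id R) (P (m + 1)) C F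
      (LinearMap.rTensor F (LinearMap.lcomp R C (d m)) x) =
        TensorProduct.rTensorHomToHomRTensor (.id R) (P m) C F x ∘ₗ d m := by
    induction x with
    | zero => simp
    | tmul r x => ext; simp
    | add y z hy hz => simp [hy, hz, LinearMap.add_comp]
  intro u hu
  obtain ⟨x, rfl⟩ := (h.homTensor_bijective F (n + 1)).2 u
  rw [← e, map_eq_zero_iff _ (h.homTensor_bijective F _).1] at hu
  obtain ⟨y, rfl⟩ := (Module.Flat.rTensor_exact F (h.dual_exact_succ n) x).mp hu
  exact ⟨_, (e _ _).symm⟩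

theorem biduality_bijective (n : ℕ) : Function.Bijective (biduality R C F (P n)) :=
  have := h.finite n
  have := h.projective n
  _root_.biduality_bijective (h.coevalTensor_bijective F)

omit h [Module.Flat R F] in
theorem biduality_rTensor (n : ℕ) (x : P (n + 1) ⊗[R] F) :
    biduality R C F (P n) (LinearMap.rTensor F (d n) x) =
      biduality R C F (P (n + 1)) x ∘ₗ LinearMap.lcomp R C (d n) := by
  induction x with
  | zero => simp
  | tmul r x => ext; simp
  | add y z hy hz => simp [hy, hz, LinearMap.add_comp]

omit h [Module.Flat R F] in
theorem biduality_comp_toSpanSingleton (x : P 0 ⊗[R] F) :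
    biduality R C F (P 0) x ∘ₗ LinearMap.toSpanSingleton R _ ε =
      LinearMap.toSpanSingleton R _ (LinearMap.rTensor F ε x) := by
  induction x with
  | zero => simp
  | tmul r x => ext; simp
  | add y z hy hz => simp [LinearMap.add_comp, hy, hz, LinearMap.toSpanSingleton_add]

/-- Biduality turns the sequence into `P_• ⊗ F`, which is exact because `F` is flat. -/
theorem dual_homExactAt_succ (n : ℕ) :
    HomExactAt (LinearMap.lcomp R C (d n)) (LinearMap.lcomp R C (d (n + 1))) (C ⊗[R] F) := by
  intro u hu
  obtain ⟨x, rfl⟩ := (h.biduality_bijective F (n + 1)).2 u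
  rw [← biduality_rTensor, map_eq_zero_iff _ (h.biduality_bijective F _).1] at hu
  obtain ⟨y, rfl⟩ := (Module.Flat.rTensor_exact F (h.exact_succ n) x).mp hu
  exact ⟨_, (biduality_rTensor _ _ _).symm⟩

theorem dual_homExactAt_zero :
    HomExactAt (LinearMap.toSpanSingleton R _ ε) (LinearMap.lcomp R C (d 0)) (C ⊗[R] F) := by
  intro u hu
  obtain ⟨x, rfl⟩ := (h.biduality_bijective F 0).2 u
  rw [biduality_comp_toSpanSingleton] at hu
  have hx : LinearMap.rTensor F ε x = 0 := by simpa using LinearMap.congr_fun hu 1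
  obtain ⟨y, rfl⟩ := (Module.Flat.rTensor_exact F h.exact_zero x).mp hx
  exact ⟨_, (biduality_rTensor _ _ _).symm⟩

omit [Module.Flat R F] in
-- This is exactness of the dual sequence at `Hom(R, C ⊗ F)`; it amounts to surjectivity of `P₀ ⊗ F
-- → C ⊗ F`.
theorem exists_comp_toSpanSingleton_eq (u : R →ₗ[R] C ⊗[R] F) :
    ∃ v : (P 0 →ₗ[R] C) →ₗ[R] C ⊗[R] F, v ∘ₗ LinearMap.toSpanSingleton R _ ε = u := by
  obtain ⟨x, hx⟩ := LinearMap.rTensor_surjective F h.surjective (u 1)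
  refine ⟨biduality R C F (P 0) x, ?_⟩
  rw [biduality_comp_toSpanSingleton, hx]
  ext; simp

end IsDualExactResolution

end Resolution

/-! ### Cycles of exact complexes, and sums of disks -/

section Complexes

variable {R : Type u} [CommRing R]

theorem ChainComplex.acyclic_iff_exact {𝒜 : Type*} [Category 𝒜] [Abelian 𝒜]
    (X : ChainComplex 𝒜 ℤ) :
    X.Acyclic ↔ ∀ j : ℤ, (X.sc' (j + 1 + 1) (j + 1) j).Exact := by
  have key (j : ℤ) : X.ExactAt (j + 1) ↔ (X.sc' (j + 1 + 1) (j + 1) j).Exact :=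
    X.exactAt_iff' _ _ _ (by simp) (by simp)
  refine ⟨fun h j => (key j).mp (h _), fun h i => ?_⟩
  obtain ⟨j, rfl⟩ : ∃ j, i = j + 1 := ⟨i - 1, by lia⟩
  exact (key j).mpr (h j)

theorem ChainComplex.acyclic_iff_function_exact (X : ChainComplex (ModuleCat.{u} R) ℤ) :
    X.Acyclic ↔
      ∀ j : ℤ, Function.Exact (X.d (j + 1 + 1) (j + 1)).hom (X.d (j + 1) j).hom :=
  X.acyclic_iff_exact.trans
    (forall_congr' fun _ => ShortComplex.ShortExact.moduleCat_exact_iff_function_exact _)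

/-- A module mapping isomorphically onto the kernel of the differential is isomorphic to the
cycles. -/
theorem nonempty_cycles_equiv (X : ChainComplex (ModuleCat.{u} R) ℤ) {K : Type u} [AddCommGroup K]
    [Module R K] (i j : ℤ) (hij : j + 1 = i) (f : K →ₗ[R] X.X i) (hf : Function.Injective f)
    (h : Function.Exact f (X.d i j).hom) : Nonempty (X.cycles i ≃ₗ[R] K) := by
  let S : ShortComplex (ModuleCat.{u} R) := ShortComplex.mk (ModuleCat.ofHom f) (X.d i j)
    (by ext x; exact h.apply_apply_eq_zero x)
  have hS : S.Exact := (ShortComplex.ShortExact.moduleCat_exact_iff_function_exact _).mpr h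
  have : Mono S.f := (ModuleCat.mono_iff_injective _).mpr hf
  exact ⟨((X.cyclesIsKernel i j (by simp [← hij])).conePointUniqueUpToIso
    hS.fIsKernel).toLinearEquiv⟩

theorem iCycles_injective (X : ChainComplex (ModuleCat.{u} R) ℤ) (i : ℤ) :
    Function.Injective (X.iCycles i).hom :=
  (ModuleCat.mono_iff_injective _).mp inferInstance

theorem iCycles_toCycles_apply (X : ChainComplex (ModuleCat.{u} R) ℤ) (i j : ℤ) (x : X.X i) :
    (X.iCycles j).hom ((X.toCycles i j).hom x) = (X.d i j).hom x := by
  rw [← X.toCycles_i i j]; rfl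

theorem exact_iCycles_d (X : ChainComplex (ModuleCat.{u} R) ℤ) (i j : ℤ) (hij : j + 1 = i) :
    Function.Exact (X.iCycles i).hom (X.d i j).hom := by
  have h : (ShortComplex.mk _ _ (X.iCycles_d i j)).Exact :=
    ShortComplex.exact_of_f_is_kernel _ (X.cyclesIsKernel i j (by simp [← hij]))
  exact (ShortComplex.ShortExact.moduleCat_exact_iff_function_exact _).mp h

theorem exact_iCycles_toCycles (X : ChainComplex (ModuleCat.{u} R) ℤ) (i j : ℤ) (hij : j + 1 = i) :
    Function.Exact (X.iCycles i).hom (X.toCycles i j).hom := by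
  intro x
  rw [← exact_iCycles_d X i j hij x, ← iCycles_toCycles_apply,
    map_eq_zero_iff _ (iCycles_injective X j)]

theorem toCycles_surjective {X : ChainComplex (ModuleCat.{u} R) ℤ} (hX : X.Acyclic) (i j : ℤ)
    (hij : j + 1 = i) : Function.Surjective (X.toCycles i j).hom := by
  intro z
  subst hij
  obtain ⟨k, rfl⟩ : ∃ k, j = k + 1 := ⟨j - 1, by lia⟩
  have hz : (X.d (k + 1) k).hom ((X.iCycles (k + 1)).hom z) = 0 :=
    (exact_iCycles_d X (k + 1) k rfl _).mpr ⟨z, rfl⟩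
  obtain ⟨x, hx⟩ := (X.acyclic_iff_function_exact.mp hX k _).mp hz
  refine ⟨x, iCycles_injective X _ ?_⟩
  rw [iCycles_toCycles_apply, hx]

/-- The direct sum over `n` of the disks `⋯ → 0 → M ⊗ Q n = M ⊗ Q n → 0 → ⋯` in degrees `n` and
`n - 1`. -/
noncomputable def diskTensor (Q : ℤ → ModuleCat.{u} R) (M : ModuleCat.{u} R) :
    ChainComplex (ModuleCat.{u} R) ℤ :=
  ChainComplex.of (fun n => ModuleCat.of R ((M ⊗[R] Q n) × (M ⊗[R] Q (n + 1))))
    (fun n => ModuleCat.ofHom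
      (LinearMap.inr R (M ⊗[R] Q n) (M ⊗[R] Q (n + 1)) ∘ₗ
        LinearMap.fst R (M ⊗[R] Q (n + 1)) (M ⊗[R] Q (n + 1 + 1))))
    (fun n => by ext <;> simp)

namespace diskTensor

variable (Q : ℤ → ModuleCat.{u} R) {M N L : ModuleCat.{u} R}

theorem d_eq (M : ModuleCat.{u} R) (n : ℤ) : (diskTensor Q M).d (n + 1) n =
    ModuleCat.ofHom (LinearMap.inr R (M ⊗[R] Q n) (M ⊗[R] Q (n + 1)) ∘ₗ
        LinearMap.fst R (M ⊗[R] Q (n + 1)) (M ⊗[R] Q (n + 1 + 1))) :=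
  ChainComplex.of_d (fun n => ModuleCat.of R ((M ⊗[R] Q n) × (M ⊗[R] Q (n + 1))))
    (fun n => ModuleCat.ofHom
      (LinearMap.inr R (M ⊗[R] Q n) (M ⊗[R] Q (n + 1)) ∘ₗ
        LinearMap.fst R (M ⊗[R] Q (n + 1)) (M ⊗[R] Q (n + 1 + 1)))) n

theorem d_apply (M : ModuleCat.{u} R) (n : ℤ) (a : M ⊗[R] Q (n + 1))
    (b : M ⊗[R] Q (n + 1 + 1)) :
    ((diskTensor Q M).d (n + 1) n).hom (a, b) = ((0, a) : (M ⊗[R] Q n) × (M ⊗[R] Q (n + 1))) := by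
  rw [d_eq]; rfl

/-- The morphism of direct sums of disks induced by a linear map. -/
noncomputable def map (f : M ⟶ N) : diskTensor Q M ⟶ diskTensor Q N :=
  ChainComplex.ofHom (fun n => ModuleCat.ofHom
    (LinearMap.prodMap (f.hom.rTensor (Q n)) (f.hom.rTensor (Q (n + 1))))) (fun n => by
      rw [d_eq, d_eq]
      ext x
      rcases x with ⟨a, b⟩
      exact Prod.ext (LinearMap.map_zero (f.hom.rTensor (Q n))).symm rfl)

theorem map_f_apply (f : M ⟶ N) (n : ℤ) (a : M ⊗[R] Q n) (b : M ⊗[R] Q (n + 1)) :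
    ((map Q f).f n).hom (a, b) =
      ((f.hom.rTensor (Q n) a, f.hom.rTensor (Q (n + 1)) b) :
        (N ⊗[R] Q n) × (N ⊗[R] Q (n + 1))) := rfl

theorem map_comp (f : M ⟶ N) (g : N ⟶ L) : map Q (f ≫ g) = map Q f ≫ map Q g := by
  ext n x
  rcases x with ⟨a, b⟩
  exact Prod.ext (LinearMap.rTensor_comp_apply _ _ _ _) (LinearMap.rTensor_comp_apply _ _ _ _)

theorem map_zero : map Q (0 : M ⟶ N) = 0 := by
  ext n x
  rcases x with ⟨a, b⟩
  exact Prod.ext (LinearMap.congr_fun (LinearMap.rTensor_zero _) _)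
    (LinearMap.congr_fun (LinearMap.rTensor_zero _) _)

theorem epi_map (f : M ⟶ N) (hf : Function.Surjective f.hom) : Epi (map Q f) :=
  HomologicalComplex.epi_of_epi_f _ fun _ => (ModuleCat.epi_iff_surjective _).mpr
    (Function.Surjective.prodMap (LinearMap.rTensor_surjective _ hf)
      (LinearMap.rTensor_surjective _ hf))

theorem mono_map (hQ : ∀ n, Module.Flat R (Q n)) (f : M ⟶ N) (hf : Function.Injective f.hom) :
    Mono (map Q f) :=
  HomologicalComplex.mono_of_mono_f _ fun _ => (ModuleCat.mono_iff_injective _).mpr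
    (Function.Injective.prodMap (Module.Flat.rTensor_preserves_injective_linearMap _ hf)
      (Module.Flat.rTensor_preserves_injective_linearMap _ hf))

theorem exact_map (hQ : ∀ n, Module.Flat R (Q n)) (f : M ⟶ N) (g : N ⟶ L)
    (hfg : Function.Exact f.hom g.hom) (n : ℤ) :
    Function.Exact ((map Q f).f n).hom ((map Q g).f n).hom := by
  rintro ⟨a, b⟩
  rw [map_f_apply]
  have h1 := Module.Flat.rTensor_exact (Q n) hfg a
  have h2 := Module.Flat.rTensor_exact (Q (n + 1)) hfg b
  constructor
  · intro h
    obtain ⟨x, hx⟩ := h1.mp (congrArg Prod.fst h)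
    obtain ⟨y, hy⟩ := h2.mp (congrArg Prod.snd h)
    exact ⟨(x, y), Prod.ext hx hy⟩
  · rintro ⟨⟨x, y⟩, h⟩
    exact Prod.ext (h1.mpr ⟨x, congrArg Prod.fst h⟩) (h2.mpr ⟨y, congrArg Prod.snd h⟩)

theorem exact_inr_d (M : ModuleCat.{u} R) (n : ℤ) :
    Function.Exact (LinearMap.inr R (M ⊗[R] Q (n + 1)) (M ⊗[R] Q (n + 1 + 1)))
      ((diskTensor Q M).d (n + 1) n).hom := by
  rintro ⟨a, b⟩
  rw [d_apply]
  constructor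
  · intro h
    have : a = 0 := congrArg Prod.snd h
    exact ⟨b, Prod.ext this.symm rfl⟩
  · rintro ⟨x, h⟩
    have : a = 0 := (congrArg Prod.fst h).symm
    exact Prod.ext rfl this

theorem acyclic (M : ModuleCat.{u} R) : (diskTensor Q M).Acyclic := by
  refine (ChainComplex.acyclic_iff_function_exact _).mpr fun n x => ?_
  refine (exact_inr_d Q M n x).trans ?_
  constructor
  · rintro ⟨b, rfl⟩
    exact ⟨(b, 0), d_apply _ _ _ _ _⟩
  · rintro ⟨⟨a, b⟩, rfl⟩
    exact ⟨a, (d_apply _ _ _ _ _).symm⟩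

theorem cycles_equiv (M : ModuleCat.{u} R) (n : ℤ) :
    Nonempty ((diskTensor Q M).cycles n ≃ₗ[R] M ⊗[R] Q (n + 1)) := by
  obtain ⟨j, rfl⟩ : ∃ j, n = j + 1 := ⟨n - 1, by lia⟩
  exact nonempty_cycles_equiv _ (j + 1) j rfl _ LinearMap.inr_injective (exact_inr_d Q M j)

/-- The morphism out of a direct sum of disks determined by its values on the generators. -/
noncomputable def desc {X : ChainComplex (ModuleCat.{u} R) ℤ}
    (φ : ∀ n, M ⊗[R] Q n →ₗ[R] X.X n) : diskTensor Q M ⟶ X :=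
  ChainComplex.ofHom (fun n => ModuleCat.ofHom
    (LinearMap.coprod (φ n) ((X.d (n + 1) n).hom ∘ₗ φ (n + 1)))) (fun n => by
      rw [d_eq]
      ext x
      rcases x with ⟨a, b⟩
      have : (X.d (n + 1) n).hom ((X.d (n + 1 + 1) (n + 1)).hom (φ (n + 1 + 1) b)) = 0 := by
        rw [← LinearMap.comp_apply, ← ModuleCat.hom_comp, X.d_comp_d]; rfl
      change (X.d (n + 1) n).hom (φ (n + 1) a + (X.d (n + 1 + 1) (n + 1)).hom (φ (n + 1 + 1) b)) =
        φ n 0 + (X.d (n + 1) n).hom (φ (n + 1) a)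
      rw [map_add, this, add_zero, LinearMap.map_zero, zero_add])

theorem desc_f_apply {X : ChainComplex (ModuleCat.{u} R) ℤ}
    (φ : ∀ n, M ⊗[R] Q n →ₗ[R] X.X n) (n : ℤ) (a : M ⊗[R] Q n) (b : M ⊗[R] Q (n + 1)) :
    ((desc Q φ).f n).hom (a, b) = φ n a + (X.d (n + 1) n).hom (φ (n + 1) b) := rfl

/-- The restriction to the generators of a morphism out of a direct sum of disks. -/
noncomputable def res {X : ChainComplex (ModuleCat.{u} R) ℤ} (g : diskTensor Q M ⟶ X) (n : ℤ) :
    M ⊗[R] Q n →ₗ[R] X.X n :=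
  (g.f n).hom ∘ₗ LinearMap.inl R (M ⊗[R] Q n) (M ⊗[R] Q (n + 1))

theorem desc_res {X : ChainComplex (ModuleCat.{u} R) ℤ} (g : diskTensor Q M ⟶ X) :
    desc Q (res Q g) = g := by
  ext n x
  rcases x with ⟨a, b⟩
  change res Q g n a + (X.d (n + 1) n).hom (res Q g (n + 1) b) = _
  have h : (X.d (n + 1) n).hom (res Q g (n + 1) b) = (g.f n).hom (0, b) := by
    rw [← d_apply Q M n b 0]
    exact LinearMap.congr_fun (congrArg ModuleCat.Hom.hom (g.comm (n + 1) n)) (b, 0)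
  rw [h]
  refine (LinearMap.map_add (g.f n).hom (a, 0) (0, b)).symm.trans ?_
  exact congrArg (g.f n).hom (Prod.ext (add_zero a) (zero_add b))

theorem map_comp_desc {X : ChainComplex (ModuleCat.{u} R) ℤ} (f : M ⟶ N)
    (φ : ∀ n, N ⊗[R] Q n →ₗ[R] X.X n) :
    map Q f ≫ desc Q φ = desc Q (fun n => φ n ∘ₗ f.hom.rTensor (Q n)) := by
  ext n x
  rcases x with ⟨a, b⟩
  rfl

/-- Morphisms from direct sums of disks to `X` are tested degreewise. -/
theorem exists_map_comp_eq (f : M ⟶ N) (g : N ⟶ L) (X : ChainComplex (ModuleCat.{u} R) ℤ)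
    (h : ∀ n, HomExactAt (f.hom.rTensor (Q n)) (g.hom.rTensor (Q n)) (X.X n))
    (u : diskTensor Q N ⟶ X) (hu : map Q f ≫ u = 0) :
    ∃ v : diskTensor Q L ⟶ X, map Q g ≫ v = u := by
  have hu' (n : ℤ) : res Q u n ∘ₗ f.hom.rTensor (Q n) = 0 := by
    refine LinearMap.ext fun a => ?_
    have h1 := LinearMap.congr_fun
      (congrArg (fun w : diskTensor Q M ⟶ X => (w.f n).hom) hu) (a, 0)
    refine Eq.trans ?_ h1
    exact congrArg (u.f n).hom (Prod.ext rfl (LinearMap.map_zero (f.hom.rTensor (Q (n + 1)))).symm)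
  choose v hv using fun n => h n (res Q u n) (hu' n)
  refine ⟨desc Q v, ?_⟩
  rw [map_comp_desc]
  simp only [hv]
  exact desc_res Q u

/-- The hypotheses say that the differential maps the image of `t n` isomorphically onto the cycles
in degree `n - 1`. Hence `X_n` is the direct sum of that image and of its own cycles, which are the
image of `d ∘ t (n + 1)`. -/
theorem nonempty_iso (X : ChainComplex (ModuleCat.{u} R) ℤ)
    (t : ∀ n, M ⊗[R] Q n →ₗ[R] X.X n)
    (hinj : ∀ n, Function.Injective ((X.d (n + 1) n).hom ∘ₗ t (n + 1)))
    (hex : ∀ n, Function.Exact ((X.d (n + 1 + 1) (n + 1)).hom ∘ₗ t (n + 1 + 1))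
      (X.d (n + 1) n).hom) : Nonempty (X ≅ diskTensor Q M) := by
  have (i : ℤ) : IsIso ((desc Q t).f i) := by
    obtain ⟨n, rfl⟩ : ∃ n, i = n + 1 := ⟨i - 1, by lia⟩
    refine (ConcreteCategory.isIso_iff_bijective _).mpr ⟨?_, ?_⟩
    · refine (injective_iff_map_eq_zero ((desc Q t).f (n + 1)).hom).mpr ?_
      rintro ⟨a, b⟩ h
      rw [desc_f_apply] at h
      have h2 := congrArg (X.d (n + 1) n).hom h
      rw [map_add, show (X.d (n + 1) n).hom ((X.d (n + 1 + 1) (n + 1)).hom _) = 0 from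
        (hex n _).mpr ⟨b, rfl⟩, add_zero, _root_.map_zero] at h2
      have ha : a = 0 := hinj n (h2.trans (_root_.map_zero _).symm)
      subst ha
      rw [_root_.map_zero, zero_add] at h
      have hb : b = 0 := hinj (n + 1) (h.trans (_root_.map_zero _).symm)
      subst hb
      rfl
    · intro x
      obtain ⟨k, rfl⟩ : ∃ k, n = k + 1 := ⟨n - 1, by lia⟩
      have hx : (X.d (k + 1) k).hom ((X.d (k + 1 + 1) (k + 1)).hom x) = 0 := by
        rw [← LinearMap.comp_apply, ← ModuleCat.hom_comp, X.d_comp_d]; rfl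
      obtain ⟨a, ha⟩ := (hex k _).mp hx
      obtain ⟨b, hb⟩ := (hex (k + 1) (x - t _ a)).mp (by
        rw [map_sub, ← ha]; exact sub_self _)
      refine ⟨(a, b), ?_⟩
      change t _ a + ((X.d _ _).hom ∘ₗ t _) b = x
      rw [hb]
      abel
  have := HomologicalComplex.Hom.isIso_of_components (desc Q t)
  exact ⟨(asIso (desc Q t)).symm⟩

end diskTensor

end Complexes

/-! ### Splicing a left and a right half into one sequence -/

section Splice

variable {R : Type u} [CommRing R]

/-- The `ℤ`-indexed family with value `K n` at `n ≥ 0` and `L n` at `-1 - n`. -/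
def spliceX (K L : ℕ → ModuleCat.{u} R) : ℤ → ModuleCat.{u} R
  | Int.ofNat n => K n
  | Int.negSucc n => L n

/-- The differentials of the sequence `⋯ → K 1 → K 0 → L 0 → L 1 → ⋯`. -/
def spliceD {K L : ℕ → ModuleCat.{u} R} (dK : ∀ n, K (n + 1) ⟶ K n) (f : K 0 ⟶ L 0)
    (dL : ∀ n, L n ⟶ L (n + 1)) : ∀ i : ℤ, spliceX K L (i + 1) ⟶ spliceX K L i
  | Int.ofNat n => dK n
  | Int.negSucc 0 => f
  | Int.negSucc (n + 1) => dL n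

/-- A pair of consecutive maps lies in the left half, lies in the right half, or contains the
connecting map `f` as second or first member. -/
theorem spliceD_rec {K L : ℕ → ModuleCat.{u} R} {dK : ∀ n, K (n + 1) ⟶ K n} {f : K 0 ⟶ L 0}
    {dL : ∀ n, L n ⟶ L (n + 1)}
    (p : ∀ {M N T : ModuleCat.{u} R}, (M ⟶ N) → (N ⟶ T) → Prop)
    (h1 : ∀ n, p (dK (n + 1)) (dK n)) (h2 : p (dK 0) f) (h3 : p f (dL 0))
    (h4 : ∀ n, p (dL n) (dL (n + 1))) :
    ∀ i : ℤ, p (spliceD dK f dL (i + 1)) (spliceD dK f dL i)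
  | Int.ofNat n => h1 n
  | Int.negSucc 0 => h2
  | Int.negSucc 1 => h3
  | Int.negSucc (n + 2) => h4 n

end Splice

/-! ### Disk decompositions and the two classes of complexes -/

section Main

variable {R : Type u} [CommRing R] {C : ModuleCat.{u} R}

theorem cProjectiveModules.cFlatModules {M : ModuleCat.{u} R} (h : cProjectiveModules C M) :
    cFlatModules C M := by
  obtain ⟨P, hP, e⟩ := h
  exact ⟨P, inferInstance, e⟩

theorem cProjectiveModules.tensor {M : ModuleCat.{u} R} (h : cProjectiveModules C M)
    (Q : ModuleCat.{u} R) [Module.Projective R Q] {N : ModuleCat.{u} R} (e : N ≃ₗ[R] M ⊗[R] Q) :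
    cProjectiveModules C N := by
  obtain ⟨P, hP, ⟨e'⟩⟩ := h
  exact ⟨ModuleCat.of R (P ⊗[R] Q), inferInstanceAs (Module.Projective R (P ⊗[R] Q)),
    ⟨e ≪≫ₗ TensorProduct.congr e' (LinearEquiv.refl R Q) ≪≫ₗ TensorProduct.assoc R C P Q⟩⟩

theorem cProjectiveModules_of_subsingleton (M : ModuleCat.{u} R) [Subsingleton M] :
    cProjectiveModules C M :=
  ⟨ModuleCat.of R PUnit, inferInstanceAs (Module.Projective R PUnit.{u + 1}),
    ⟨(0 : M ≃ₗ[R] C ⊗[R] PUnit.{u + 1})⟩⟩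

theorem cProjectiveModules_self : cProjectiveModules C C :=
  ⟨ModuleCat.of R R, inferInstanceAs (Module.Projective R R), ⟨(TensorProduct.rid R C).symm⟩⟩

theorem cProjectiveModules_hom (P : Type u) [AddCommGroup P] [Module R P] [Module.Finite R P]
    [Module.Projective R P] : cProjectiveModules C (ModuleCat.of R (P →ₗ[R] C)) := by
  let e : (P →ₗ[R] R) ⊗[R] C ≃ₗ[R] (P →ₗ[R] R ⊗[R] C) :=
    LinearEquiv.ofBijective _ rTensorHomToHomRTensor_bijective
  exact ⟨ModuleCat.of R (Module.Dual R P), inferInstanceAs (Module.Projective R (Module.Dual R P)),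
    ⟨(e ≪≫ₗ (TensorProduct.lid R C).congrRight).symm ≪≫ₗ TensorProduct.comm R _ _⟩⟩

/-- This is the vanishing of `Ext¹(A, H)`. For `A = C` it follows from exactness of `Hom(P_•, C ⊗
F)` in degree `1`. -/
theorem IsSemidualizing.liftsAlong (hC : IsSemidualizing C) {A : ModuleCat.{u} R}
    (hA : projectiveModules R A ∨ cProjectiveModules C A) {H : ModuleCat.{u} R}
    (hH : cFlatModules C H) {M N : Type u} [AddCommGroup M] [Module R M] [AddCommGroup N]
    [Module R N] {i : H →ₗ[R] M} {q : M →ₗ[R] N} (hi : Function.Injective i)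
    (hiq : Function.Exact i q) (hq : Function.Surjective q) : LiftsAlong A q := by
  rcases hA with hA | ⟨P, hP, ⟨e⟩⟩
  · have : Module.Projective R A := hA
    exact Module.Projective.liftsAlong hq
  · obtain ⟨F, hF, ⟨eF⟩⟩ := hH
    obtain ⟨P, d, ε, h⟩ := hC.exists_dualExactResolution
    have := h.projective 0
    exact (LiftsAlong.of_presentation (h.exact_succ 0).linearMap_comp_eq_zero h.exact_zero
      h.surjective hi hiq hq ((h.homExactAt_succ F 0).of_equiv eF)).tensor.of_equiv e

/-- The terms of a `C`-flat complex need not be visibly `C`-flat, but each is an extension of one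
cycle module by another, and these are. -/
theorem IsSemidualizing.homExactAt_complexesOf (hC : IsSemidualizing C)
    {X : ChainComplex (ModuleCat.{u} R) ℤ} (hX : complexesOf (cFlatModules C) X)
    {A B : Type u} [AddCommGroup A] [Module R A] [AddCommGroup B] [Module R B]
    {D : ModuleCat.{u} R} (hD : projectiveModules R D ∨ cProjectiveModules C D)
    {f : A →ₗ[R] B} {g : B →ₗ[R] D} (hgf : g ∘ₗ f = 0)
    (h : ∀ F : ModuleCat.{u} R, Module.Flat R F → HomExactAt f g (C ⊗[R] F)) (n : ℤ) :
    HomExactAt f g (X.X n) := by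
  have hcyc (k : ℤ) : HomExactAt f g (X.cycles k) := by
    obtain ⟨F, hF, ⟨e⟩⟩ := hX.2 k
    exact (h F hF).of_equiv e
  obtain ⟨m, rfl⟩ : ∃ m, n = m + 1 := ⟨n - 1, by lia⟩
  have hi := iCycles_injective X (m + 1)
  have hiq := exact_iCycles_toCycles X (m + 1) m rfl
  exact HomExactAt.of_extension hgf hi hiq
    (hC.liftsAlong hD (hX.2 _) hi hiq (toCycles_surjective hX.1 _ _ rfl)) (hcyc _) (hcyc _)

/-- A complex whose cycles have the form `B ⊗ Q` and which splits is a direct sum of disks. -/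
theorem exists_iso_diskTensor {X : ChainComplex (ModuleCat.{u} R) ℤ}
    (B : ModuleCat.{u} R)
    (hB : ∀ n, ∃ Q : ModuleCat.{u} R, Module.Projective R Q ∧
      Nonempty (X.cycles n ≃ₗ[R] B ⊗[R] Q))
    (hl : ∀ n, LiftsAlong (X.cycles n) (X.toCycles (n + 1) n).hom) :
    ∃ Q : ℤ → ModuleCat.{u} R, (∀ n, Module.Projective R (Q n)) ∧
      Nonempty (X ≅ diskTensor Q B) := by
  have key (n : ℤ) : ∃ (Q : ModuleCat.{u} R) (t : B ⊗[R] Q →ₗ[R] X.X n), Module.Projective R Q ∧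
      ∀ m, m + 1 = n → Function.Injective ((X.d n m).hom ∘ₗ t) ∧
        ∀ k, k + 1 = m → Function.Exact ((X.d n m).hom ∘ₗ t) (X.d m k).hom := by
    obtain ⟨m, rfl⟩ : ∃ m, n = m + 1 := ⟨n - 1, by lia⟩
    obtain ⟨Q, hQ, ⟨e⟩⟩ := hB m
    -- Lifting the identity of the cycles gives a section of `X_{m+1} → Z_m`, so `d ∘ s` is the
    -- inclusion of `Z_m`.
    obtain ⟨s, hs⟩ := hl m LinearMap.id
    have hd : (X.d (m + 1) m).hom ∘ₗ s ∘ₗ e.symm.toLinearMap =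
        (X.iCycles m).hom ∘ₗ e.symm.toLinearMap := by
      refine LinearMap.ext fun x => ?_
      have := LinearMap.congr_fun hs (e.symm x)
      simp only [LinearMap.comp_apply, LinearMap.id_apply] at this
      simp only [LinearMap.comp_apply, LinearEquiv.coe_coe]
      rw [← iCycles_toCycles_apply, this]
    refine ⟨Q, s ∘ₗ e.symm.toLinearMap, hQ, fun m' hm' => ?_⟩
    obtain rfl : m' = m := by lia
    rw [hd]
    refine ⟨(iCycles_injective X m').comp e.symm.injective, fun k hk x => ?_⟩
    rw [exact_iCycles_d X m' k hk x]
    constructor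
    · rintro ⟨z, rfl⟩
      exact ⟨e z, by simp⟩
    · rintro ⟨z, rfl⟩
      exact ⟨e.symm z, rfl⟩
  choose Q t hQ ht using key
  exact ⟨Q, hQ, diskTensor.nonempty_iso Q X t (fun n => (ht _ _ rfl).1)
    (fun n => (ht _ _ rfl).2 _ rfl)⟩

/-- A sequence of modules `⋯ → S 0 → S (-1) → ⋯` exhibiting `B` as a `D_C`-projective module
exhibits sums of disks on `B ⊗ Q n`, with `Q n` projective, as `D_C`-projective complexes. -/
theorem IsSemidualizing.isDCProjective_of_sequence (hC : IsSemidualizing C)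
    {S : ℤ → ModuleCat.{u} R} (dS : ∀ i, S (i + 1) ⟶ S i)
    (hex : ∀ i, Function.Exact (dS (i + 1)).hom (dS i).hom)
    (hHom : ∀ i, ∀ F : ModuleCat.{u} R, Module.Flat R F →
      HomExactAt (dS (i + 1)).hom (dS i).hom (C ⊗[R] F))
    (hproj : ∀ i, 0 ≤ i → projectiveModules R (S i))
    (hCproj : ∀ i, i < 0 → cProjectiveModules C (S i))
    {B : ModuleCat.{u} R} (e : S (-1 + 1) ⟶ B) (he : Function.Surjective e.hom)
    (m : B ⟶ S (-1)) (hm : Function.Injective m.hom) (hem : e ≫ m = dS (-1))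
    {Q : ℤ → ModuleCat.{u} R} (hQ : ∀ n, Module.Projective R (Q n))
    {X : ChainComplex (ModuleCat.{u} R) ℤ} (hX : Nonempty (X ≅ diskTensor Q B)) :
    IsDCProjective C X := by
  have hflat (n : ℤ) : Module.Flat R (Q n) := inferInstance
  have sq (n : ℤ) : dS (n + 1) ≫ dS n = 0 := by
    ext x; exact (hex n).apply_apply_eq_zero x
  have sq' (n : ℤ) : diskTensor.map Q (dS (n + 1)) ≫ diskTensor.map Q (dS n) = 0 := by
    rw [← diskTensor.map_comp, sq, diskTensor.map_zero]
  let T : ChainComplex (ChainComplex (ModuleCat.{u} R) ℤ) ℤ :=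
    ChainComplex.of (fun i => diskTensor Q (S i)) (fun i => diskTensor.map Q (dS i)) sq'
  have hT (j : ℤ) : T.d (j + 1) j = diskTensor.map Q (dS j) :=
    ChainComplex.of_d (fun i => diskTensor Q (S i)) (fun i => diskTensor.map Q (dS i)) j
  have hS (i : ℤ) : projectiveModules R (S i) ∨ cProjectiveModules C (S i) :=
    (le_or_gt 0 i).imp (hproj i) (hCproj i)
  have hST {i : ℤ} (n : ℤ) : projectiveModules R (ModuleCat.of R (S i ⊗[R] Q n)) ∨
      cProjectiveModules C (ModuleCat.of R (S i ⊗[R] Q n)) := by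
    refine (hS i).imp (fun h => ?_) (fun h => h.tensor (Q n) (LinearEquiv.refl R _))
    have : Module.Projective R (S i) := h
    exact inferInstanceAs (Module.Projective R (S i ⊗[R] Q n))
  refine ⟨T, ?_, ?_, ?_, ?_, ?_⟩
  · refine (ChainComplex.acyclic_iff_exact T).mpr fun j =>
      HomologicalComplex.exact_of_degreewise_exact _ fun n =>
        (ShortComplex.ShortExact.moduleCat_exact_iff_function_exact _).mpr ?_
    change Function.Exact ((T.d (j + 1 + 1) (j + 1)).f n).hom ((T.d (j + 1) j).f n).hom
    rw [hT, hT]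
    exact diskTensor.exact_map Q hflat _ _ (hex j) n
  · intro H hH i
    -- The differential of `T` is known in the form `T.d (k + 1) k`, so `i - 1` is replaced by a
    -- variable `k` with `k + 1 = i`.
    suffices ∀ i k : ℤ, k + 1 = i → Function.Exact (fun g : T.X k ⟶ H => T.d i k ≫ g)
        (fun g : T.X i ⟶ H => T.d (i + 1) i ≫ g) from this i (i - 1) (by lia)
    rintro _ k rfl u
    constructor
    · intro hu
      rw [hT] at hu
      obtain ⟨v, hv⟩ := diskTensor.exists_map_comp_eq Q (dS (k + 1)) (dS k) H (fun n =>
        hC.homExactAt_complexesOf hH (D := ModuleCat.of R (S k ⊗[R] Q n)) (hST n) (by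
          rw [← LinearMap.rTensor_comp, (hex k).linearMap_comp_eq_zero, LinearMap.rTensor_zero])
          (fun F hF => (hHom k F hF).tensor) n) u hu
      refine ⟨v, ?_⟩
      dsimp only
      rw [hT]
      exact hv
    · rintro ⟨v, rfl⟩
      dsimp only
      rw [← Category.assoc, T.d_comp_d, Limits.zero_comp]
  · intro i hi
    refine ⟨diskTensor.acyclic Q _, fun n => ?_⟩
    obtain ⟨e⟩ := diskTensor.cycles_equiv Q (S i) n
    have : Module.Projective R (S i) := hproj i hi
    exact Module.Projective.of_equiv e.symm
  · intro i hi
    refine ⟨diskTensor.acyclic Q _, fun n => ?_⟩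
    obtain ⟨e⟩ := diskTensor.cycles_equiv Q (S i) n
    exact (hCproj i hi).tensor (Q (n + 1)) e
  · obtain ⟨φ⟩ := hX
    have := diskTensor.epi_map Q e he
    have := diskTensor.mono_map Q hflat m hm
    have := strongEpi_of_epi (diskTensor.map Q e)
    exact ⟨φ ≪≫ Limits.image.isoStrongEpiMono (diskTensor.map Q e) (diskTensor.map Q m) (by
      -- The index `-1 + 1` reduces to `0`, so `hT (-1)` concerns `T.d 0 (-1)`, whose epi-mono
      -- factorization determines its image.
      rw [← diskTensor.map_comp, hem, ← hT (-1)]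
      rfl)⟩

theorem IsSemidualizing.isDCProjective_of_projective (hC : IsSemidualizing C)
    {X : ChainComplex (ModuleCat.{u} R) ℤ} (hX : complexesOf (projectiveModules R) X) :
    IsDCProjective C X := by
  have hcyc (n : ℤ) : Module.Projective R (X.cycles n) := hX.2 n
  obtain ⟨Q, hQ, hiso⟩ := exists_iso_diskTensor (ModuleCat.of R R)
    (fun n => ⟨X.cycles n, hcyc n, ⟨(TensorProduct.lid R _).symm⟩⟩)
    (fun n => Module.Projective.liftsAlong (toCycles_surjective hX.1 _ _ rfl))
  obtain ⟨P, d, ε, h⟩ := hC.exists_dualExactResolution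
  -- Here `S 0 = R`, with zero modules to its left and the dual resolution from index `-1` on; the
  -- image of `S 0 → S (-1)` is `R`.
  let K : ℕ → ModuleCat.{u} R
    | 0 => ModuleCat.of R R
    | _ + 1 => ModuleCat.of R PUnit
  let L : ℕ → ModuleCat.{u} R := fun n => ModuleCat.of R (P n →ₗ[R] C)
  let f : K 0 ⟶ L 0 := ModuleCat.ofHom (LinearMap.toSpanSingleton R (P 0 →ₗ[R] C) ε)
  let dK : ∀ n, K (n + 1) ⟶ K n := fun _ => 0
  let dL : ∀ n, L n ⟶ L (n + 1) := fun n => ModuleCat.ofHom (LinearMap.lcomp R C (d n))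
  have hK (n : ℕ) : Subsingleton (K (n + 1)) := inferInstanceAs (Subsingleton PUnit)
  refine hC.isDCProjective_of_sequence (spliceD dK f dL) ?_ ?_ ?_ ?_
    (𝟙 (K 0)) Function.surjective_id f h.dual_injective (Category.id_comp _) hQ hiso
  · refine spliceD_rec (fun a b => Function.Exact a.hom b.hom) (fun n x => ?_) (fun x => ?_)
      h.dual_exact_zero h.dual_exact_succ
    · exact ⟨fun _ => ⟨0, Subsingleton.elim _ _⟩, fun _ => rfl⟩
    · exact (map_eq_zero_iff _ h.dual_injective).trans
        ⟨fun hx => ⟨0, hx.symm⟩, fun ⟨y, hy⟩ => hy.symm⟩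
  · refine spliceD_rec (fun a b => ∀ F : ModuleCat.{u} R, Module.Flat R F →
      HomExactAt a.hom b.hom (C ⊗[R] F)) (fun n F hF u hu => ?_) (fun F hF u hu => ?_)
      (fun F hF => h.dual_homExactAt_zero F) (fun n F hF => h.dual_homExactAt_succ F n)
    · exact ⟨0, LinearMap.ext fun x => by rw [Subsingleton.elim x 0, map_zero, map_zero]⟩
    · exact h.exists_comp_toSpanSingleton_eq F u
  · rintro ((_ | n) | n) hi
    · exact inferInstanceAs (Module.Projective R R)
    · exact inferInstanceAs (Module.Projective R PUnit.{u + 1})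
    · simp at hi
  · rintro (n | n) hi
    · exact absurd hi (by simp)
    · have := h.finite n
      have := h.projective n
      exact cProjectiveModules_hom (P n)

theorem IsSemidualizing.isDCProjective_of_cProjective (hC : IsSemidualizing C)
    {X : ChainComplex (ModuleCat.{u} R) ℤ} (hX : complexesOf (cProjectiveModules C) X) :
    IsDCProjective C X := by
  obtain ⟨Q, hQ, hiso⟩ := exists_iso_diskTensor C hX.2
    (fun n => hC.liftsAlong (Or.inr (hX.2 n)) (hX.2 (n + 1)).cFlatModules
      (iCycles_injective X (n + 1)) (exact_iCycles_toCycles X (n + 1) n rfl)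
      (toCycles_surjective hX.1 _ _ rfl))
  obtain ⟨P, d, ε, h⟩ := hC.exists_dualExactResolution
  -- Here `C` sits at index `-1`, with its resolution to the left and zero modules to the right; the
  -- image of `P₀ → C` is all of `C`.
  let L : ℕ → ModuleCat.{u} R
    | 0 => C
    | _ + 1 => ModuleCat.of R PUnit
  let f : P 0 ⟶ L 0 := ModuleCat.ofHom ε
  let dK : ∀ n, P (n + 1) ⟶ P n := fun n => ModuleCat.ofHom (d n)
  let dL : ∀ n, L n ⟶ L (n + 1) := fun _ => 0
  have hL (n : ℕ) : Subsingleton (L (n + 1)) := inferInstanceAs (Subsingleton PUnit)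
  refine hC.isDCProjective_of_sequence (spliceD dK f dL) ?_ ?_ ?_ ?_
    f h.surjective (𝟙 C) Function.injective_id (Category.comp_id _) hQ hiso
  · refine spliceD_rec (fun a b => Function.Exact a.hom b.hom) h.exact_succ h.exact_zero
      (fun x => ?_) (fun n x => ?_)
    · exact ⟨fun _ => h.surjective x, fun _ => rfl⟩
    · exact ⟨fun _ => ⟨0, Subsingleton.elim _ _⟩, fun _ => rfl⟩
  · refine spliceD_rec (fun a b => ∀ F : ModuleCat.{u} R, Module.Flat R F →
      HomExactAt a.hom b.hom (C ⊗[R] F)) (fun n F hF => h.homExactAt_succ F n)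
      (fun F hF => HomExactAt.of_exact h.exact_zero h.surjective)
      (fun F hF u hu => ⟨0, ?_⟩) (fun n F hF u hu => ⟨0, ?_⟩)
    · refine LinearMap.ext fun c => ?_
      obtain ⟨p, rfl⟩ := h.surjective c
      exact (LinearMap.congr_fun hu p).symm
    · exact LinearMap.ext fun x => by rw [Subsingleton.elim x 0, map_zero, map_zero]
  · rintro (n | n) hi
    · exact h.projective n
    · simp at hi
  · rintro (n | (_ | n)) hi
    · exact absurd hi (by simp)
    · exact cProjectiveModules_self
    · exact cProjectiveModules_of_subsingleton (ModuleCat.of R PUnit)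

end Main

theorem corollary2p9 {R : Type u} [CommRing R] (C : ModuleCat.{u} R) (hC : IsSemidualizing C)
    (X : ChainComplex (ModuleCat.{u} R) ℤ) :
    (complexesOf (projectiveModules R) X → IsDCProjective C X) ∧
      (complexesOf (cProjectiveModules C) X → IsDCProjective C X) :=
  ⟨hC.isDCProjective_of_projective, hC.isDCProjective_of_cProjective⟩
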